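/- Let $G$ be a finite group. The generating graph $\Gamma(G)$ of $G$ is the simple graph whose vertices are the nontrivial elements of $G$, two vertices being adjacent if and only if they are distinct and generate $G$. For $1 \neq g \in G$, let $\delta(g)$ denote the degree of the vertex $g$ in $\Gamma(G)$. Let $G^{\mathrm{ab}} = G/G'$ be the abelianization of $G$, where $G' = [G,G]$ is the commutator subgroup, and let $\epsilon \in \{1,2\}$ be such that $\epsilon = 1$ if and only if $G^{\mathrm{ab}}$ has odd order. If $1 \neq g \in G$ and $2^{\epsilon}$ divides $|N_G(\langle g\rangle)|$, where $N_G(\langle g\rangle)$ is the normalizer in $G$ of the cyclic subgroup $\langle g\rangle$, then $\delta(g)$ is even. -/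

import Mathlib

/-- The generating graph of a group `G`: its vertices are the nontrivial elements of `G`, and two
vertices are adjacent if and only if they are distinct and generate `G`. -/
def generatingGraph (G : Type*) [Group G] : SimpleGraph {x : G // x ≠ 1} where
  Adj x y := x ≠ y ∧ Subgroup.closure {(x : G), (y : G)} = ⊤
  symm := ⟨fun _ _ h => ⟨h.1.symm, by rw [Set.pair_comm]; exact h.2⟩⟩
  loopless := ⟨fun _ h => h.1 rfl⟩

/-! Let `X` be the set of `y` generating `G` together with `g`, and `M` the normal closure of `g`.
If `X` is nonempty, `G ⧸ M` is cyclic, and the hypothesis on `ε` yields an involution `t`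
normalizing `⟨g⟩` that is a square modulo `M`. Sending `y` to `y * t` if `t` and `y` commute, and to
`t * y * t⁻¹` otherwise, is a fixed-point-free involution of `X`; that `y * t` stays in `X` is
`closure_pair_mul_eq_top`, where squareness is needed. So `|X|` is even, and the degree is `|X \ {1,
g}|`. -/

namespace Finset

/-- A finite set with a fixed-point-free involution has even cardinality. -/
theorem even_card_of_fixedPointFree_involution {α : Type*} (s : Finset α) (f : α → α)
    (hmem : ∀ a ∈ s, f a ∈ s) (hinv : ∀ a ∈ s, f (f a) = a) (hne : ∀ a ∈ s, f a ≠ a) :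
    Even s.card := by
  have h : ∑ _a ∈ s, (1 : ZMod 2) = 0 :=
    sum_involution (fun a _ => f a) (fun _ _ => by decide) (fun a ha _ => hne a ha)
      hmem hinv
  rw [← ZMod.natCast_eq_zero_iff_even]
  simpa using h

end Finset

namespace Subgroup

variable {G : Type*} [Group G]

/-- Any subgroup containing `g` and `y` is everything if `g` and `y` generate. -/
theorem eq_top_of_closure_pair_eq_top {g y : G} (h : closure {g, y} = ⊤) {H : Subgroup G}
    (hg : g ∈ H) (hy : y ∈ H) : H = ⊤ := by
  rw [eq_top_iff, ← h, closure_le]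
  rintro z (rfl | rfl) <;> assumption

/-- Conjugating `y` by an element normalizing `⟨g⟩` preserves the property of generating
together with `g`. -/
theorem closure_pair_conj_eq_top {g y t : G} (h : closure {g, y} = ⊤)
    (ht : t ∈ normalizer (zpowers g : Set G)) : closure {g, t * y * t⁻¹} = ⊤ := by
  set K := closure {g, t * y * t⁻¹}
  have hgK : zpowers g ≤ K := zpowers_le.2 (subset_closure (by simp))
  have hcomap : K.comap (MulAut.conj t).toMonoidHom = ⊤ := by
    refine eq_top_of_closure_pair_eq_top h ?_ ?_
    · exact hgK ((mem_normalizer_iff.1 ht g).1 (mem_zpowers g))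
    · exact subset_closure (by simp)
  rw [eq_top_iff]
  intro z _
  have hz : t⁻¹ * z * t ∈ K.comap (MulAut.conj t).toMonoidHom := hcomap ▸ mem_top _
  simpa [mul_assoc] using hz

/-- If `g` and `y` generate, then `y` generates modulo any normal subgroup containing `g`. -/
theorem zpowers_mk_eq_top_of_closure_pair_eq_top {g y : G} (h : closure {g, y} = ⊤)
    (N : Subgroup G) [N.Normal] (hg : g ∈ N) : zpowers (y : G ⧸ N) = ⊤ := by
  have key : (zpowers (y : G ⧸ N)).comap (QuotientGroup.mk' N) = ⊤ := by
    refine eq_top_of_closure_pair_eq_top h ?_ (mem_zpowers _)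
    rw [mem_comap, QuotientGroup.mk'_apply, (QuotientGroup.eq_one_iff g).2 hg]
    exact one_mem _
  rw [eq_top_iff]
  intro z _
  obtain ⟨z, rfl⟩ := QuotientGroup.mk'_surjective N z
  exact mem_comap.1 (key ▸ mem_top z)

/-- Suppose that `g` and `y` generate, that the involution `t` normalizes `⟨g⟩` and commutes with
`y`, and that `t` is a square modulo the normal closure of `g`. Then `g` and `y * t` generate. -/
theorem closure_pair_mul_eq_top {g y t s : G} (h : closure {g, y} = ⊤)
    (ht : t ∈ normalizer (zpowers g : Set G)) (ht2 : t ^ 2 = 1) (hty : t * y = y * t)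
    (hs : s ^ 2 * t⁻¹ ∈ normalClosure {g}) : closure {g, y * t} = ⊤ := by
  set H := closure {g, y * t} with hH
  have hgH : g ∈ H := subset_closure (by simp)
  have hytH : y * t ∈ H := subset_closure (by simp)
  have htN : t ∈ normalizer (H : Set G) := by
    have hle : H ≤ H.comap (MulAut.conj t).toMonoidHom := by
      rw [hH, closure_le]
      rintro z (rfl | rfl)
      · exact zpowers_le.2 hgH ((mem_normalizer_iff.1 ht z).1 (mem_zpowers z))
      · have : t * (y * t) * t⁻¹ = y * t := by rw [← mul_assoc, hty]; group
        simpa [this] using hytH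
    refine mem_normalizer_iff.2 fun z => ⟨fun hz => hle hz, fun hz => ?_⟩
    have hz' : t * (t * z * t⁻¹) * t⁻¹ ∈ H := hle hz
    have : t * (t * z * t⁻¹) * t⁻¹ = t ^ 2 * z * (t ^ 2)⁻¹ := by
      simp only [sq, mul_inv_rev, mul_assoc]
    rw [this, ht2] at hz'
    simpa using hz'
  have hyN : y ∈ normalizer (H : Set G) := by
    simpa using mul_mem (le_normalizer hytH) (inv_mem htN)
  have : H.Normal := normalizer_eq_top_iff.1 <|
    eq_top_of_closure_pair_eq_top h (le_normalizer hgH) hyN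
  have hMH : normalClosure {g} ≤ H := normalClosure_le_normal (by simpa using hgH)
  -- In `G ⧸ H`, generated by `y = t⁻¹`, every square is trivial; `t = s ^ 2` is one, so `t` and
  -- hence `y` lie in `H`.
  obtain ⟨k, hk⟩ : (s : G ⧸ H) ∈ zpowers (y : G ⧸ H) := by
    rw [zpowers_mk_eq_top_of_closure_pair_eq_top h H hgH]; exact mem_top _
  have hst : (s : G ⧸ H) ^ 2 = (t : G ⧸ H) := by
    have := (QuotientGroup.eq_one_iff _).2 (hMH hs)
    rw [QuotientGroup.mk_mul, QuotientGroup.mk_inv, mul_inv_eq_one] at this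
    exact this
  have hyt : (y : G ⧸ H) * t = 1 := (QuotientGroup.eq_one_iff _).2 hytH
  have ht2' : (t : G ⧸ H) ^ 2 = 1 := by
    rw [← QuotientGroup.mk_pow, ht2, QuotientGroup.mk_one]
  have hy2 : (y : G ⧸ H) ^ 2 = 1 := by
    rw [eq_inv_of_mul_eq_one_left hyt, inv_pow, ht2', inv_one]
  have ht1 : (t : G ⧸ H) = 1 := by
    dsimp only at hk
    rw [← hst, ← hk, ← zpow_natCast, zpow_comm, zpow_natCast, hy2, one_zpow]
  refine eq_top_of_closure_pair_eq_top h hgH ?_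
  rwa [ht1, mul_one, QuotientGroup.eq_one_iff] at hyt

/-- A normal subgroup `N` with cyclic quotient meets every subgroup of order `4` and exponent `2`
nontrivially. -/
theorem exists_ne_one_mem_of_isCyclic_quotient [Finite G] (N T : Subgroup G) [N.Normal]
    [IsCyclic (G ⧸ N)] (hT : Nat.card T = 4) (hexp : ∀ x ∈ T, x ^ 2 = 1) :
    ∃ t ∈ T, t ≠ 1 ∧ t ∈ N := by
  classical
  have := Fintype.ofFinite (G ⧸ N)
  have := Fintype.ofFinite T
  -- Pigeonhole: `a ^ 2 = 1` has at most two solutions in a cyclic group.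
  have hcard : (Finset.univ.filter fun a : G ⧸ N => a ^ 2 = 1).card <
      (Finset.univ : Finset T).card := by
    have := IsCyclic.card_pow_eq_one_le (α := G ⧸ N) two_pos
    rw [Finset.card_univ, ← Nat.card_eq_fintype_card, hT]
    omega
  obtain ⟨u, -, v, -, huv, he⟩ := Finset.exists_ne_map_eq_of_card_lt_of_maps_to hcard
    (f := fun u : T => ((u : G) : G ⧸ N)) (fun u _ => by
      simp [← QuotientGroup.mk_pow, hexp u u.2])
  refine ⟨(u : G)⁻¹ * v, mul_mem (inv_mem u.2) v.2, fun h => huv ?_, QuotientGroup.eq.1 he⟩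
  exact Subtype.ext (inv_mul_eq_one.1 h)

end Subgroup

open Subgroup

/-- If `g` is part of a generating pair and `2 ^ ε` divides the order of the normalizer `N` of
`⟨g⟩`, then `N` contains an involution that is a square modulo the normal closure of `g`. -/
theorem exists_involution_mem_normalizer_zpowers {G : Type*} [Group G] [Finite G] {g y : G}
    (h : closure {g, y} = ⊤)
    (ε : ℕ) (hε : ε = 1 ∨ ε = 2) (hε_iff : ε = 1 ↔ Odd (Nat.card (Abelianization G)))
    (hN : 2 ^ ε ∣ Nat.card (normalizer (zpowers g : Set G))) :
    ∃ t ∈ normalizer (zpowers g : Set G), t ≠ 1 ∧ t ^ 2 = 1 ∧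
      ∃ s : G, s ^ 2 * t⁻¹ ∈ normalClosure {g} := by
  set M := normalClosure {g}
  have hgM : g ∈ M := subset_normalClosure (by simp)
  have hcyc : IsCyclic (G ⧸ M) :=
    ⟨y, fun x => (zpowers_mk_eq_top_of_closure_pair_eq_top h M hgM).ge (mem_top x)⟩
  have := Fact.mk Nat.prime_two
  obtain rfl | rfl := hε
  · have hodd : Odd (Nat.card (G ⧸ M)) := by
      have hle : commutator G ≤ M := by
        let _ : CommGroup (G ⧸ M) := IsCyclic.commGroup
        have := Abelianization.commutator_subset_ker (QuotientGroup.mk' M)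
        rwa [QuotientGroup.ker_mk'] at this
      exact (hε_iff.1 rfl).of_dvd_nat (index_dvd_of_le hle)
    obtain ⟨⟨t, htN⟩, ht⟩ := exists_prime_orderOf_dvd_card' 2 (by simpa using hN)
    rw [orderOf_mk, orderOf_eq_prime_iff] at ht
    obtain ⟨m, hm⟩ := hodd
    -- Since `|G ⧸ M| = 2 * m + 1`, squaring `t ^ (m + 1)` gives back `t` modulo `M`.
    refine ⟨t, htN, ht.2, ht.1, t ^ (m + 1), ?_⟩
    rw [← QuotientGroup.eq_one_iff, ← pow_mul, show (m + 1) * 2 = (2 * m + 1) + 1 by ring, ← hm,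
      pow_succ, mul_inv_cancel_right, QuotientGroup.mk_pow, pow_card_eq_one']
  · obtain ⟨T, hT⟩ := Sylow.exists_subgroup_card_pow_prime 2 hN
    have hT' : Nat.card (T.map (Subgroup.subtype _)) = 4 := by
      rw [card_map_of_injective (subtype_injective _), hT]; rfl
    have hTN := map_subtype_le T
    set S := T.map (Subgroup.subtype _)
    -- If `S` is a Klein four-group, it has an involution in `M`, so `1` serves as square root;
    -- otherwise take the square of an element of order 4.
    by_cases hexp : ∀ x ∈ S, x ^ 2 = 1
    · obtain ⟨t, htS, ht1, htM⟩ := exists_ne_one_mem_of_isCyclic_quotient M S hT' hexp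
      exact ⟨t, hTN htS, ht1, hexp t htS, 1, by simpa using htM⟩
    · push Not at hexp
      obtain ⟨s, hsS, hs⟩ := hexp
      refine ⟨s ^ 2, hTN (pow_mem hsS 2), hs, ?_, s, by simp⟩
      rw [← pow_mul]
      simpa [hT'] using congrArg Subtype.val (pow_card_eq_one' (x := (⟨s, hsS⟩ : S)))

/-- The number of elements generating `G` together with `g` is even. -/
theorem even_card_filter_closure_pair_eq_top {G : Type*} [Group G] [Fintype G] (g : G)
    [DecidablePred fun y : G => closure {g, y} = ⊤]
    (ε : ℕ) (hε : ε = 1 ∨ ε = 2) (hε_iff : ε = 1 ↔ Odd (Nat.card (Abelianization G)))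
    (hN : 2 ^ ε ∣ Nat.card (normalizer (zpowers g : Set G))) :
    Even (Finset.univ.filter fun y : G => closure {g, y} = ⊤).card := by
  classical
  obtain hX | ⟨y₀, hy₀⟩ := (Finset.univ.filter fun y : G => closure {g, y} = ⊤).eq_empty_or_nonempty
  · simp [hX]
  obtain ⟨t, htN, ht1, ht2, s, hs⟩ := exists_involution_mem_normalizer_zpowers
    (Finset.mem_filter.1 hy₀).2 ε hε hε_iff hN
  have htt : t * t = 1 := by rw [← sq, ht2]
  have hti : t⁻¹ = t := inv_eq_of_mul_eq_one_left htt
  refine Finset.even_card_of_fixedPointFree_involution _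
    (fun y => if t * y = y * t then y * t else t * y * t⁻¹) ?_ ?_ ?_
  · intro y hy
    rw [Finset.mem_filter_univ] at hy ⊢
    split_ifs with hc
    · exact closure_pair_mul_eq_top hy htN ht2 hc hs
    · exact closure_pair_conj_eq_top hy htN
  · intro y _
    by_cases hc : t * y = y * t
    · have : t * (y * t) = y * t * t := by rw [← mul_assoc, hc]
      simp [hc, this, mul_assoc, htt]
    · have : ¬ t * (t * y * t⁻¹) = t * y * t⁻¹ * t := by
        intro h'
        apply hc
        rw [inv_mul_cancel_right] at h'
        exact mul_inv_eq_iff_eq_mul.1 (mul_left_cancel h')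
      simp only [hc, this, if_false]
      rw [hti]
      simp [← mul_assoc, htt, mul_assoc y t t]
  · intro y _
    split_ifs with hc
    · simpa using ht1
    · rwa [ne_eq, mul_inv_eq_iff_eq_mul]

theorem propositionp {G : Type*} [Group G] [Finite G] (g : G) (hg : g ≠ 1)
    [Fintype ((generatingGraph G).neighborSet ⟨g, hg⟩)]
    (ε : ℕ) (hε : ε = 1 ∨ ε = 2) (hε_iff : ε = 1 ↔ Odd (Nat.card (Abelianization G)))
    (hN : 2 ^ ε ∣ Nat.card (Subgroup.normalizer (Subgroup.zpowers g : Set G))) :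
    Even ((generatingGraph G).degree ⟨g, hg⟩) := by
  classical
  have := Fintype.ofFinite G
  have hX := even_card_filter_closure_pair_eq_top g ε hε hε_iff hN
  set X := Finset.univ.filter fun y : G => closure {g, y} = ⊤ with hXdef
  have hmap : ((generatingGraph G).neighborFinset ⟨g, hg⟩).map (Function.Embedding.subtype _) =
      (X.erase g).erase 1 := by
    ext y
    simp only [Finset.mem_map, SimpleGraph.mem_neighborFinset, Function.Embedding.subtype_apply,
      Finset.mem_erase, hXdef, Finset.mem_filter_univ]
    constructor
    · rintro ⟨⟨z, hz⟩, ⟨hgz, htop⟩, rfl⟩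
      exact ⟨hz, fun h' => hgz (Subtype.ext h'.symm), htop⟩
    · rintro ⟨hy, hyg, htop⟩
      exact ⟨⟨y, hy⟩, ⟨fun h' => hyg (congrArg Subtype.val h').symm, htop⟩, rfl⟩
  have hone : 1 ∈ X ↔ g ∈ X := by
    have h1 : closure {g, 1} = closure {g} := by rw [Set.pair_comm, closure_insert_one]
    simp [hXdef, h1]
  rw [SimpleGraph.degree, ← Finset.card_map (Function.Embedding.subtype _), hmap]
  -- Either both of `1 ≠ g` are removed from `X` or neither is, so parity is kept.
  by_cases hgX : g ∈ X
  · have h1X : 1 ∈ X.erase g := Finset.mem_erase.2 ⟨hg.symm, hone.2 hgX⟩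
    rw [← Finset.card_erase_add_one hgX, ← Finset.card_erase_add_one h1X] at hX
    simpa [Nat.even_add_one] using hX
  · rwa [Finset.erase_eq_of_notMem hgX, Finset.erase_eq_of_notMem (mt hone.1 hgX)]
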